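/- Let $d\ge 0$, let $X\subseteq\mathbb{R}^d$ be open and convex, and let $F:X\to\mathbb{R}$ be strictly convex and differentiable, with Bregman divergence $D_F(p\|q)=F(p)-F(q)-\langle\nabla F(q),p-q\rangle$. For $c\in X$ and $r\in\mathbb{R}$, the (first-type) Bregman sphere and open Bregman ball with centre $c$ and radius $r$ are $\{x\in X: D_F(x\|c)=r\}$ and $\{x\in X: D_F(x\|c)<r\}$. Let $S\subset X$ be a finite set whose affine hull is $\mathbb{R}^d$. A triangulation of $S$ is a geometric simplicial complex whose vertex set is $S$ and whose underlying space is $\operatorname{conv}(S)$; its facets are its maximal simplices (which are $d$-simplices). The Bregman Delaunay triangulation $\mathrm{del}_F(S)$ is the collection of the projections to $\mathbb{R}^d$ of all nonempty faces (of all dimensions) of the lower facets of $\operatorname{conv}\{(p,F(p)):p\in S\}\subset\mathbb{R}^{d+1}$, a lower facet being a $d$-dimensional face cut out by a supporting hyperplane $z=\langle a,x\rangle+b$ that lies below all the points $(p,F(p))$. The set $S$ is in general position if no $d+2$ of its points lie on a same Bregman sphere. A pair of adjacent facets $f_1=f\cup\{p_1\}$, $f_2=f\cup\{p_2\}$ with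 $p_1\ne p_2$ and $p_1,p_2\notin f$ is regular if $f_1$ and $f_2$ have circumscribing Bregman spheres (spheres through all their vertices; these are then unique), $p_1$ is not in the open Bregman ball circumscribing $f_2$, and $p_2$ is not in the open Bregman ball circumscribing $f_1$. **Theorem (Locality).** (i) If $S$ is in general position, then any triangulation of $S$ in which every pair of adjacent facets is regular is the Bregman Delaunay triangulation $\mathrm{del}_F(S)$ (that is, its set of simplices equals $\mathrm{del}_F(S)$). (ii) The same holds if, both in the definition of general position and in that of regularity, Bregman spheres and open balls are replaced by the sets $\{x\in X: F(x)=\langle a,x\rangle+b\}$ and $\{x\in X: F(x)<\langle a,x\rangle+b\}$ with arbitrary $a\in\mathbb{R}^d$, $b\in\mathbb{R}$, i.e. the projections of the parts of the graph of $F$ that lie on, respectively strictly below, a non-vertical hyperplane (Bregman spheres and balls are the case $a\in\nabla F(X)$; through the lifted vertices of a facet there is always exactly one such hyperplane). -/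

import Mathlib

noncomputable section

namespace BregmanGeometry

variable {d : ℕ}

/-- The Bregman divergence `D_F(p ‖ q) = F(p) - F(q) - ⟨∇F(q), p - q⟩`. -/
def divergence (F : EuclideanSpace ℝ (Fin d) → ℝ) (p q : EuclideanSpace ℝ (Fin d)) : ℝ :=
  F p - F q - inner ℝ (gradient F q) (p - q)

/-- The first-type Bregman sphere with centre `c` and radius `r`. -/
def sphere (X : Set (EuclideanSpace ℝ (Fin d))) (F : EuclideanSpace ℝ (Fin d) → ℝ)
    (c : EuclideanSpace ℝ (Fin d)) (r : ℝ) : Set (EuclideanSpace ℝ (Fin d)) :=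
  {x ∈ X | divergence F x c = r}

/-- The open first-type Bregman ball with centre `c` and radius `r`. -/
def openBall (X : Set (EuclideanSpace ℝ (Fin d))) (F : EuclideanSpace ℝ (Fin d) → ℝ)
    (c : EuclideanSpace ℝ (Fin d)) (r : ℝ) : Set (EuclideanSpace ℝ (Fin d)) :=
  {x ∈ X | divergence F x c < r}

/-- The projection to `X` of the section of the graph of `F` by the non-vertical hyperplane
`z = ⟨a, x⟩ + b`. -/
def section_ (X : Set (EuclideanSpace ℝ (Fin d))) (F : EuclideanSpace ℝ (Fin d) → ℝ)
    (a : EuclideanSpace ℝ (Fin d)) (b : ℝ) : Set (EuclideanSpace ℝ (Fin d)) :=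
  {x ∈ X | F x = inner ℝ a x + b}

/-- The projection to `X` of the part of the graph of `F` strictly below the non-vertical
hyperplane `z = ⟨a, x⟩ + b`. -/
def openCap (X : Set (EuclideanSpace ℝ (Fin d))) (F : EuclideanSpace ℝ (Fin d) → ℝ)
    (a : EuclideanSpace ℝ (Fin d)) (b : ℝ) : Set (EuclideanSpace ℝ (Fin d)) :=
  {x ∈ X | F x < inner ℝ a x + b}

/-- A Bregman sphere is the section by the translate of the tangent hyperplane at its centre. -/
theorem sphere_eq_section (X : Set (EuclideanSpace ℝ (Fin d)))
    (F : EuclideanSpace ℝ (Fin d) → ℝ) (c : EuclideanSpace ℝ (Fin d)) (r : ℝ) :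
    sphere X F c r =
      section_ X F (gradient F c) (F c - inner ℝ (gradient F c) c + r) := by
  ext x
  simp only [sphere, section_, divergence, inner_sub_right, Set.mem_ofPred_eq]
  constructor <;> rintro ⟨hx, h⟩ <;> exact ⟨hx, by linarith⟩

/-- An open Bregman ball is the cap below the translate of the tangent hyperplane at its
centre. -/
theorem openBall_eq_openCap (X : Set (EuclideanSpace ℝ (Fin d)))
    (F : EuclideanSpace ℝ (Fin d) → ℝ) (c : EuclideanSpace ℝ (Fin d)) (r : ℝ) :
    openBall X F c r =
      openCap X F (gradient F c) (F c - inner ℝ (gradient F c) c + r) := by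
  ext x
  simp only [openBall, openCap, divergence, inner_sub_right, Set.mem_ofPred_eq]
  constructor <;> rintro ⟨hx, h⟩ <;> exact ⟨hx, by linarith⟩

/-- General position: no `d + 2` points of `S` lie on a same Bregman sphere. -/
def GeneralPosition (X : Set (EuclideanSpace ℝ (Fin d))) (F : EuclideanSpace ℝ (Fin d) → ℝ)
    (S : Finset (EuclideanSpace ℝ (Fin d))) : Prop :=
  ∀ U : Finset (EuclideanSpace ℝ (Fin d)), U ⊆ S → U.card = d + 2 →
    ∀ c ∈ X, ∀ r : ℝ, ¬ (U : Set (EuclideanSpace ℝ (Fin d))) ⊆ sphere X F c r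

/-- General position, read on the lifted points: no `d + 2` of the lifted points `(p, F p)` lie
on a same non-vertical hyperplane. -/
def LiftedGeneralPosition (X : Set (EuclideanSpace ℝ (Fin d)))
    (F : EuclideanSpace ℝ (Fin d) → ℝ) (S : Finset (EuclideanSpace ℝ (Fin d))) : Prop :=
  ∀ U : Finset (EuclideanSpace ℝ (Fin d)), U ⊆ S → U.card = d + 2 →
    ∀ (a : EuclideanSpace ℝ (Fin d)) (b : ℝ),
      ¬ (U : Set (EuclideanSpace ℝ (Fin d))) ⊆ section_ X F a b

/-- A triangulation of `S`: a geometric simplicial complex with vertex set `S` that covers the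
convex hull of `S`. -/
structure IsTriangulation (T : Geometry.SimplicialComplex ℝ (EuclideanSpace ℝ (Fin d)))
    (S : Finset (EuclideanSpace ℝ (Fin d))) : Prop where
  vertices_eq : T.vertices = S
  space_eq : T.space = convexHull ℝ (S : Set (EuclideanSpace ℝ (Fin d)))

/-- `p` does not belong to the open Bregman ball circumscribing the `d`-simplex with vertex set
`g`. (For `d + 1` affinely independent points there is at most one circumscribing ball.) -/
def OutsideCircumball (X : Set (EuclideanSpace ℝ (Fin d)))
    (F : EuclideanSpace ℝ (Fin d) → ℝ) (g : Finset (EuclideanSpace ℝ (Fin d)))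
    (p : EuclideanSpace ℝ (Fin d)) : Prop :=
  ∃ c ∈ X, ∃ r : ℝ,
    (g : Set (EuclideanSpace ℝ (Fin d))) ⊆ sphere X F c r ∧ p ∉ openBall X F c r

/-- `p` does not belong to the projection of the part of the graph of `F` strictly below the
hyperplane through the lifted vertices of the `d`-simplex with vertex set `g`. (For `d + 1`
affinely independent points there is exactly one such hyperplane.) -/
def OutsideCircumcap (X : Set (EuclideanSpace ℝ (Fin d)))
    (F : EuclideanSpace ℝ (Fin d) → ℝ) (g : Finset (EuclideanSpace ℝ (Fin d)))
    (p : EuclideanSpace ℝ (Fin d)) : Prop :=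
  ∃ (a : EuclideanSpace ℝ (Fin d)) (b : ℝ),
    (g : Set (EuclideanSpace ℝ (Fin d))) ⊆ section_ X F a b ∧ p ∉ openCap X F a b

/-- All pairs of adjacent facets `(f, p₁)`, `(f, p₂)` of `T` are regular: neither opposite vertex
lies in the open Bregman ball circumscribing the other facet. -/
def AllPairsRegular (X : Set (EuclideanSpace ℝ (Fin d))) (F : EuclideanSpace ℝ (Fin d) → ℝ)
    (T : Geometry.SimplicialComplex ℝ (EuclideanSpace ℝ (Fin d))) : Prop :=
  ∀ (f : Finset (EuclideanSpace ℝ (Fin d))) (p₁ p₂ : EuclideanSpace ℝ (Fin d))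
    (h₁ : p₁ ∉ f) (h₂ : p₂ ∉ f), p₁ ≠ p₂ →
    Finset.cons p₁ f h₁ ∈ T.facets → Finset.cons p₂ f h₂ ∈ T.facets →
      OutsideCircumball X F (Finset.cons p₂ f h₂) p₁ ∧
      OutsideCircumball X F (Finset.cons p₁ f h₁) p₂

/-- All pairs of adjacent facets `(f, p₁)`, `(f, p₂)` of `T` are regular, read on the lifted
points. -/
def AllPairsLiftedRegular (X : Set (EuclideanSpace ℝ (Fin d)))
    (F : EuclideanSpace ℝ (Fin d) → ℝ)
    (T : Geometry.SimplicialComplex ℝ (EuclideanSpace ℝ (Fin d))) : Prop :=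
  ∀ (f : Finset (EuclideanSpace ℝ (Fin d))) (p₁ p₂ : EuclideanSpace ℝ (Fin d))
    (h₁ : p₁ ∉ f) (h₂ : p₂ ∉ f), p₁ ≠ p₂ →
    Finset.cons p₁ f h₁ ∈ T.facets → Finset.cons p₂ f h₂ ∈ T.facets →
      OutsideCircumcap X F (Finset.cons p₂ f h₂) p₁ ∧
      OutsideCircumcap X F (Finset.cons p₁ f h₁) p₂

/-- The lifted image `{(p, F p) | p ∈ S}` of `S`. -/
def lift (F : EuclideanSpace ℝ (Fin d) → ℝ) (S : Finset (EuclideanSpace ℝ (Fin d))) :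
    Set (EuclideanSpace ℝ (Fin d) × ℝ) :=
  (fun p => (p, F p)) '' (S : Set (EuclideanSpace ℝ (Fin d)))

/-- The non-vertical hyperplane `z = ⟨a, x⟩ + b`. -/
def hyperplane (a : EuclideanSpace ℝ (Fin d)) (b : ℝ) : Set (EuclideanSpace ℝ (Fin d) × ℝ) :=
  {z | z.2 = inner ℝ a z.1 + b}

/-- The lower convex hull of the lifted points: the facets of their convex hull (faces spanning
their supporting hyperplane) whose supporting hyperplane is below the lifted points. -/
def lowerHullFacets (F : EuclideanSpace ℝ (Fin d) → ℝ)
    (S : Finset (EuclideanSpace ℝ (Fin d))) : Set (Set (EuclideanSpace ℝ (Fin d) × ℝ)) :=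
  {φ | ∃ (a : EuclideanSpace ℝ (Fin d)) (b : ℝ),
    (∀ z ∈ lift F S, inner ℝ a z.1 + b ≤ z.2) ∧
    φ = convexHull ℝ (lift F S) ∩ hyperplane a b ∧
    (affineSpan ℝ φ : Set (EuclideanSpace ℝ (Fin d) × ℝ)) = hyperplane a b}

/-- The Bregman Delaunay triangulation of `S`, as the collection of its cells of all dimensions:
the vertical projections of the nonempty faces of the facets of the lower convex hull. -/
def delaunay (F : EuclideanSpace ℝ (Fin d) → ℝ) (S : Finset (EuclideanSpace ℝ (Fin d))) :
    Set (Set (EuclideanSpace ℝ (Fin d))) :=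
  {σ | ∃ φ ∈ lowerHullFacets F S, ∃ ψ : Set (EuclideanSpace ℝ (Fin d) × ℝ),
    ψ.Nonempty ∧ IsExposed ℝ φ ψ ∧ σ = Prod.fst '' ψ}

/-- The collection of the (closed, nonempty) simplices of a simplicial complex, as point sets. -/
def simplices (T : Geometry.SimplicialComplex ℝ (EuclideanSpace ℝ (Fin d))) :
    Set (Set (EuclideanSpace ℝ (Fin d))) :=
  {σ | ∃ s ∈ T.faces, σ = convexHull ℝ (s : Set (EuclideanSpace ℝ (Fin d)))}

end BregmanGeometry

end

/-!
Call a face of the triangulation with `d + 1` vertices a cell, and for a cell `s` let `h_s` be the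
affine function that agrees with `F` on the vertices of `s`. A section of the graph of `F` through
the vertices of `s` is necessarily the section by the graph of `h_s`, so regularity of adjacent
facets says that `h_s ≤ F` at the vertex of each adjacent cell that is not in `s`, and general
position makes the inequality strict (`strictlyLocallyConvex_of_sections`). Bregman spheres are
particular sections, so both parts of the theorem reduce to this strict local convexity of
the lifted complex.

The passage from local to global (`apply_lt_of_strictlyLocallyConvex`) is a maximum argument that
avoids walking through the triangulation along a generic segment. Fix a vertex `p` and let `s` be a
cell not containing it. Some barycentric coordinate `c` of `p` with respect to `s` is negative, and
since `p` lies in the triangulated convex set, there is a cell `s'` on the other side of the wall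
`c = 0` of `s` (`exists_adjacent_cell`). The difference of `h_{s'}` and `h_s` vanishes on the wall,
so it is a multiple of `c`; it is positive at the new vertex of `s'`, hence also at `p`. So `h_s(p)`
is strictly smaller than `h_{s'}(p)`. A cell maximizing the value at `p` thus contains `p`, the
maximum is `F(p)`, and `h_s(p) < F(p)` for all cells `s` without `p`.

Consequently the graph of every `h_s` is a supporting hyperplane touching the lifted points exactly
in the vertices of `s`, and since every face lies in a cell (`exists_cell_superset`), all simplices
are projections of faces of lower facets. Conversely, let a lower facet be spanned by the lift of a
set `u`. The barycentre of `u` lies in a cell `t`, and there the two supporting functions bound each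
other from both sides; this forces them to agree on `u`, hence everywhere, so that `u = t`
(`contact_set_mem_faces`).
-/

open Module Filter Topology

namespace BregmanGeometry

/-! ### Affine functions and convex hulls -/

section Affine

variable {V : Type*} [AddCommGroup V] [Module ℝ V]

theorem affineMap_le_of_mem_convexHull {P : Set V} {h : V →ᵃ[ℝ] ℝ} {m : ℝ}
    (hP : ∀ p ∈ P, h p ≤ m) {x : V} (hx : x ∈ convexHull ℝ P) : h x ≤ m :=
  convexHull_min (t := h ⁻¹' Set.Iic m) hP ((convex_Iic m).affine_preimage h) hx

theorem affineMap_eq_of_mem_convexHull {P : Set V} {h : V →ᵃ[ℝ] ℝ} {m : ℝ}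
    (hP : ∀ p ∈ P, h p = m) {x : V} (hx : x ∈ convexHull ℝ P) : h x = m :=
  convexHull_min (t := h ⁻¹' {m}) hP ((convex_singleton m).affine_preimage h) hx

/-- The face of a convex hull on which an affine function attains its upper bound `m` is the convex
hull of the generators at which it attains `m`. -/
theorem convexHull_inter_level {P : Set V} {h : V →ᵃ[ℝ] ℝ} {m : ℝ} (hP : ∀ p ∈ P, h p ≤ m) :
    convexHull ℝ P ∩ {x | h x = m} = convexHull ℝ {p ∈ P | h p = m} := by
  have hC : ∀ x ∈ convexHull ℝ {p ∈ P | h p = m}, h x = m :=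
    fun x hx => affineMap_eq_of_mem_convexHull (fun p hp => hp.2) hx
  apply Set.Subset.antisymm
  · -- Points strictly below the level, together with the claimed face, form a convex set.
    have hQ : Convex ℝ {x | h x < m ∨ x ∈ convexHull ℝ {p ∈ P | h p = m}} := by
      intro x hx y hy a b ha hb hab
      have hcomb : h (a • x + b • y) = a * h x + b * h y := by
        simpa using Convex.combo_affine_apply (f := h) hab
      have hx' : h x ≤ m := hx.elim le_of_lt fun h' => (hC x h').le
      have hy' : h y ≤ m := hy.elim le_of_lt fun h' => (hC y h').le
      rcases ha.eq_or_lt with rfl | ha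
      · obtain rfl : b = 1 := by linarith
        simpa using hy
      rcases hb.eq_or_lt with rfl | hb
      · obtain rfl : a = 1 := by linarith
        simpa using hx
      have hm : a * m + b * m = m := by rw [← add_mul, hab, one_mul]
      rcases hx with hx | hx
      · left
        rw [hcomb]
        nlinarith
      rcases hy with hy | hy
      · left
        rw [hcomb]
        nlinarith
      · exact Or.inr (convex_convexHull ℝ _ hx hy ha.le hb.le hab)
    have hPQ : convexHull ℝ P ⊆ {x | h x < m ∨ x ∈ convexHull ℝ {p ∈ P | h p = m}} :=
      convexHull_min (fun p hp => (hP p hp).lt_or_eq.imp_right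
        fun h' => subset_convexHull ℝ _ ⟨hp, h'⟩) hQ
    rintro x ⟨hx, hxm⟩
    exact (hPQ hx).resolve_left (not_lt_of_ge (le_of_eq hxm.symm))
  · exact fun x hx => ⟨convexHull_mono (fun p hp => hp.1) hx, hC x hx⟩

/-- The barycentre of `s`, described by the values of affine functions at it. -/
theorem exists_mem_convexHull_card_mul_eq_sum {s : Finset V} (hs : s.Nonempty) :
    ∃ x ∈ convexHull ℝ (s : Set V), ∀ h : V →ᵃ[ℝ] ℝ, (s.card : ℝ) * h x = ∑ v ∈ s, h v := by
  have hc : (s.card : ℝ) ≠ 0 := by simpa using hs.ne_empty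
  refine ⟨s.centroid ℝ id, s.centroid_mem_convexHull hs, fun h => ?_⟩
  rw [Finset.centroid_def, Finset.map_affineCombination _ _ _
      (s.sum_centroidWeights_eq_one_of_nonempty ℝ hs),
    Finset.affineCombination_eq_linear_combination _ _ _
      (s.sum_centroidWeights_eq_one_of_nonempty ℝ hs)]
  simp only [Finset.centroidWeights_apply, Function.comp_apply, id_eq, smul_eq_mul,
    ← Finset.mul_sum]
  rw [mul_inv_cancel_left₀ hc]

theorem exists_affineMap_eqOn [FiniteDimensional ℝ V] {s : Finset V}
    (hs : AffineIndependent ℝ ((↑) : s → V)) (g : V → ℝ) :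
    ∃ h : V →ᵃ[ℝ] ℝ, ∀ v ∈ s, h v = g v := by
  obtain ⟨t, hst, hti, htop⟩ := exists_subset_affineIndependent_affineSpan_eq_top
    (k := ℝ) (s := (s : Set V)) hs
  have := (finite_set_of_fin_dim_affineIndependent ℝ hti).fintype
  let b : AffineBasis t ℝ V := ⟨(↑), hti, by simpa using htop⟩
  refine ⟨∑ i : t, g i • b.coord i, fun v hv => ?_⟩
  have hsum : ∀ u : Finset t, (∑ i ∈ u, g i • b.coord i) v = ∑ i ∈ u, g i * b.coord i v := by
    classical
    intro u
    induction u using Finset.induction_on with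
    | empty => simp
    | insert a u ha ih => simp [Finset.sum_insert ha, ih]
  have hv' : b ⟨v, hst hv⟩ = v := rfl
  rw [hsum, Finset.sum_eq_single_of_mem (⟨v, hst hv⟩ : t) (Finset.mem_univ _)]
  · have := b.coord_apply_eq ⟨v, hst hv⟩
    rw [hv'] at this
    rw [this, mul_one]
  · intro i _ hi
    have := b.coord_apply_ne hi
    rw [hv'] at this
    rw [this, mul_zero]

theorem affineSpan_eq_top_of_card [FiniteDimensional ℝ V] {s : Finset V}
    (hs : AffineIndependent ℝ ((↑) : s → V)) (hcard : s.card = finrank ℝ V + 1) :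
    affineSpan ℝ (s : Set V) = ⊤ := by
  have := hs.affineSpan_eq_top_iff_card_eq_finrank_add_one.2 (by simpa using hcard)
  simpa using this

theorem card_le_of_affineIndependent [FiniteDimensional ℝ V] {s : Finset V}
    (hs : AffineIndependent ℝ ((↑) : s → V)) : s.card ≤ finrank ℝ V + 1 := by
  have := hs.card_le_finrank_succ.trans (Nat.succ_le_succ (Submodule.finrank_le _))
  simpa using this

/-- A point outside a full-dimensional simplex is strictly beyond one of its walls: the barycentric
coordinate of some vertex `v` is negative there. -/
theorem exists_barycentric_neg [FiniteDimensional ℝ V] {s : Finset V}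
    (hs : AffineIndependent ℝ ((↑) : s → V)) (hcard : s.card = finrank ℝ V + 1)
    {p : V} (hp : p ∉ convexHull ℝ (s : Set V)) :
    ∃ v ∈ s, ∃ c : V →ᵃ[ℝ] ℝ, c v = 1 ∧ (∀ w ∈ s, w ≠ v → c w = 0) ∧ c p < 0 := by
  let b : AffineBasis s ℝ V :=
    ⟨(↑), hs, by simpa using affineSpan_eq_top_of_card hs hcard⟩
  have hb : convexHull ℝ (s : Set V) = {x | ∀ i, 0 ≤ b.coord i x} := by
    rw [← b.convexHull_eq_nonneg_coord]
    exact congrArg _ Subtype.range_coe.symm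
  rw [hb] at hp
  simp only [Set.mem_ofPred_eq, not_forall, not_le] at hp
  obtain ⟨v, hv⟩ := hp
  refine ⟨v, v.2, b.coord v, b.coord_apply_eq v, fun w hw hwv => ?_, hv⟩
  exact b.coord_apply_ne (i := v) (j := ⟨w, hw⟩) fun h => hwv (congrArg Subtype.val h).symm

end Affine

/-! ### Full-dimensional cells of a triangulation -/

section Complex

variable {V : Type*} [NormedAddCommGroup V] [NormedSpace ℝ V]
  {K : Geometry.SimplicialComplex ℝ V}

/-- If the barycentre of a face `f` lies in a simplex of the complex, then `f` is a face of that
simplex. -/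
theorem subset_of_barycentre_mem [FiniteDimensional ℝ V] {f t : Finset V} (hf : f ∈ K.faces)
    (ht : t ∈ K.faces) {x : V} (hxf : x ∈ convexHull ℝ (f : Set V))
    (hx : ∀ h : V →ᵃ[ℝ] ℝ, (f.card : ℝ) * h x = ∑ v ∈ f, h v)
    (hxt : x ∈ convexHull ℝ (t : Set V)) : f ⊆ t := by
  classical
  intro w hw
  by_contra hwt
  obtain ⟨h, hh⟩ := exists_affineMap_eqOn (K.indep hf) (fun v => if v = w then 1 else 0)
  have h0 : h x = 0 := by
    refine affineMap_eq_of_mem_convexHull (fun p hp => ?_)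
      (K.inter_subset_convexHull hf ht ⟨hxf, hxt⟩)
    rw [hh p hp.1, if_neg]
    rintro rfl
    exact hwt hp.2
  have h1 := hx h
  rw [h0, Finset.sum_congr rfl hh, mul_zero] at h1
  simp [hw] at h1

/-- Near any point `x`, a finite complex only has simplices that contain `x`. -/
theorem eventually_mem_face_through (hK : K.faces.Finite) (x : V) :
    ∀ᶠ y in 𝓝 x, y ∈ K.space →
      ∃ t ∈ K.faces, x ∈ convexHull ℝ (t : Set V) ∧ y ∈ convexHull ℝ (t : Set V) := by
  have h : ∀ᶠ y in 𝓝 x, ∀ t ∈ K.faces, x ∉ convexHull ℝ (t : Set V) →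
      y ∉ convexHull ℝ (t : Set V) := by
    rw [eventually_all_finite hK]
    intro t _
    by_cases hx : x ∈ convexHull ℝ (t : Set V)
    · exact Eventually.of_forall fun y h => absurd hx h
    · filter_upwards [(t.finite_toSet.isClosed_convexHull (𝕜 := ℝ)).isOpen_compl.mem_nhds hx]
        with y hy _ using hy
  filter_upwards [h] with y hy hyK
  obtain ⟨t, ht, hyt⟩ := Geometry.SimplicialComplex.mem_space_iff.1 hyK
  exact ⟨t, ht, by_contra fun hx => hy t ht hx hyt, hyt⟩

variable [FiniteDimensional ℝ V]

/-- A triangulation of a full-dimensional convex set is pure: the points near the barycentre of a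
face cannot all be covered by lower-dimensional simplices, which have measure zero. -/
theorem exists_cell_superset (hK : K.faces.Finite) (hconv : Convex ℝ K.space)
    (hint : (interior K.space).Nonempty) {f : Finset V} (hf : f ∈ K.faces) :
    ∃ t ∈ K.faces, f ⊆ t ∧ t.card = finrank ℝ V + 1 := by
  obtain ⟨x, hxf, hx⟩ :=
    exists_mem_convexHull_card_mul_eq_sum (K.nonempty_of_mem_faces hf)
  by_contra! hno
  have hxK : x ∈ closure (interior K.space) := by
    rw [hconv.closure_interior_eq_closure_of_nonempty_interior hint]
    exact subset_closure (K.convexHull_subset_space hf hxf)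
  obtain ⟨U, hU, hUo, hxU⟩ := mem_nhds_iff.1 (eventually_mem_face_through hK x)
  have hne : (U ∩ interior K.space).Nonempty := mem_closure_iff.1 hxK U hUo hxU
  let _ : MeasurableSpace V := borel V
  have : BorelSpace V := ⟨rfl⟩
  let μ : MeasureTheory.Measure V := MeasureTheory.Measure.addHaar
  have hpos : 0 < μ (U ∩ interior K.space) :=
    (hUo.inter isOpen_interior).measure_pos μ hne
  refine hpos.ne' (MeasureTheory.measure_mono_null
    (t := ⋃ t ∈ {t ∈ K.faces | affineSpan ℝ (t : Set V) ≠ ⊤}, (affineSpan ℝ (t : Set V) : Set V))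
    ?_ ?_)
  · rintro y ⟨hyU, hyK⟩
    obtain ⟨t, ht, hxt, hyt⟩ := hU hyU (interior_subset hyK)
    refine Set.mem_biUnion (x := t) ⟨ht, fun htop => ?_⟩ (convexHull_subset_affineSpan _ hyt)
    refine hno t ht (subset_of_barycentre_mem hf ht hxf hx hxt) ?_
    have := (K.indep ht).affineSpan_eq_top_iff_card_eq_finrank_add_one.1 (by simpa using htop)
    simpa using this
  · rw [MeasureTheory.measure_biUnion_null_iff (hK.subset fun _ h => h.1).countable]
    exact fun t ht => MeasureTheory.Measure.addHaar_affineSubspace μ _ ht.2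

/-- Crossing a wall: if some point of the triangulated convex set lies strictly beyond the wall
`s \ {v}` of a cell `s`, then there is another cell across that wall. The function `c` is the
barycentric coordinate of `v`. -/
theorem exists_adjacent_cell [DecidableEq V] (hK : K.faces.Finite) (hconv : Convex ℝ K.space)
    {s : Finset V} (hs : s ∈ K.faces) (hcard : s.card = finrank ℝ V + 1) {v : V} (hv : v ∈ s)
    {c : V →ᵃ[ℝ] ℝ} (hcv : c v = 1) (hc0 : ∀ w ∈ s, w ≠ v → c w = 0)
    {p : V} (hp : p ∈ K.space) (hcp : c p < 0) :
    ∃ v' ∉ s, insert v' (s.erase v) ∈ K.faces ∧ c v' < 0 := by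
  have hcf : ∀ w ∈ s.erase v, c w = 0 := fun w hw =>
    hc0 w (Finset.mem_of_mem_erase hw) (Finset.ne_of_mem_erase hw)
  have hfcard : (s.erase v).card = finrank ℝ V := by
    rw [Finset.card_erase_of_mem hv, hcard, Nat.add_sub_cancel]
  have hfne : (s.erase v).Nonempty := by
    rw [Finset.nonempty_iff_ne_empty]
    intro h0
    have : finrank ℝ V = 0 := by rw [← hfcard, h0, Finset.card_empty]
    have := finrank_zero_iff.1 this
    rw [Subsingleton.elim p v, hcv] at hcp
    linarith
  have hf : s.erase v ∈ K.faces := K.down_closed hs (s.erase_subset v) hfne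
  obtain ⟨x, hxf, hx⟩ := exists_mem_convexHull_card_mul_eq_sum hfne
  have hcx : c x = 0 := affineMap_eq_of_mem_convexHull hcf hxf
  -- Move from the barycentre `x` of the wall a little towards `p`.
  have hlim : Tendsto (fun ε : ℝ => AffineMap.lineMap x p ε) (𝓝[>] 0) (𝓝 x) := by
    have : Continuous fun ε : ℝ => (AffineMap.lineMap x p ε : V) := AffineMap.lineMap_continuous
    simpa using (this.tendsto 0).mono_left nhdsWithin_le_nhds
  obtain ⟨ε, hε, hε1⟩ := ((hlim.eventually (eventually_mem_face_through hK x)).and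
    (Ioo_mem_nhdsGT (zero_lt_one (α := ℝ)))).exists
  obtain ⟨t, ht, hxt, hyt⟩ := hε (hconv.lineMap_mem (K.convexHull_subset_space hf hxf) hp
    ⟨hε1.1.le, hε1.2.le⟩)
  have hcy : c (AffineMap.lineMap x p ε) < 0 := by
    rw [AffineMap.apply_lineMap, hcx, AffineMap.lineMap_apply_module']
    simpa using mul_neg_of_pos_of_neg hε1.1 hcp
  have hft : s.erase v ⊆ t := subset_of_barycentre_mem hf ht hxf hx hxt
  obtain ⟨v', hv't, hcv'⟩ : ∃ v' ∈ t, c v' < 0 := by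
    by_contra! hno
    have := affineMap_le_of_mem_convexHull (h := -c) (m := 0)
      (fun w hw => by simpa using hno w hw) hyt
    simp only [AffineMap.coe_neg, Pi.neg_apply] at this
    linarith
  have hv's : v' ∉ s := by
    intro h
    rcases eq_or_ne v' v with rfl | hne
    · linarith
    · linarith [hc0 v' h hne]
  refine ⟨v', hv's, ?_, hcv'⟩
  have hsub : insert v' (s.erase v) ⊆ t := Finset.insert_subset hv't hft
  exact K.down_closed ht hsub (Finset.insert_nonempty _ _)

/-! ### From local to global convexity -/

/-- Whenever two full-dimensional cells `f ∪ {p₁}` and `f ∪ {p₂}` share the wall `f`, the affine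
function interpolating `F` on the vertices of one of them lies strictly below `F` at the opposite
vertex of the other. The roles of `p₁` and `p₂` being symmetric, one inequality is stated. -/
def StrictlyLocallyConvex (K : Geometry.SimplicialComplex ℝ V) (F : V → ℝ) : Prop :=
  ∀ (f : Finset V) (p₁ p₂ : V) (h₁ : p₁ ∉ f) (h₂ : p₂ ∉ f), p₁ ≠ p₂ → f.card = finrank ℝ V →
    Finset.cons p₁ f h₁ ∈ K.faces → Finset.cons p₂ f h₂ ∈ K.faces →
      ∀ h : V →ᵃ[ℝ] ℝ, (∀ q ∈ Finset.cons p₂ f h₂, h q = F q) → h p₁ < F p₁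

/-- If the vertex `p` is not in the cell `s`, crossing a wall of `s` towards `p` strictly increases
the value at `p` of the affine interpolation of `F`. -/
theorem exists_cell_lt_apply (hK : K.faces.Finite) (hconv : Convex ℝ K.space) {F : V → ℝ}
    (hF : StrictlyLocallyConvex K F) {s : Finset V} (hs : s ∈ K.faces)
    (hcard : s.card = finrank ℝ V + 1) {h : V →ᵃ[ℝ] ℝ} (hh : ∀ q ∈ s, h q = F q)
    {p : V} (hp : p ∈ K.vertices) (hps : p ∉ s) :
    ∃ s' ∈ K.faces, s'.card = finrank ℝ V + 1 ∧
      ∀ h' : V →ᵃ[ℝ] ℝ, (∀ q ∈ s', h' q = F q) → h p < h' p := by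
  classical
  obtain ⟨v, hv, c, hcv, hc0, hcp⟩ := exists_barycentric_neg (K.indep hs) hcard
    (fun hmem => hps ((K.vertex_mem_convexHull_iff hp hs).1 hmem))
  obtain ⟨v', hv's, hs', hcv'⟩ := exists_adjacent_cell hK hconv hs hcard hv hcv hc0
    (K.vertices_subset_space hp) hcp
  have hv'f : v' ∉ s.erase v := fun h => hv's (Finset.mem_of_mem_erase h)
  have hfcard : (s.erase v).card = finrank ℝ V := by
    rw [Finset.card_erase_of_mem hv, hcard, Nat.add_sub_cancel]
  refine ⟨_, hs', by rw [Finset.card_insert_of_notMem hv'f, hfcard], fun h' hh' => ?_⟩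
  have hlt : h v' < F v' := by
    refine hF (s.erase v) v' v hv'f (s.notMem_erase v) ?_ hfcard ?_ ?_ h ?_
    · rintro rfl
      exact hv's hv
    · rwa [Finset.cons_eq_insert]
    · rwa [Finset.cons_eq_insert, Finset.insert_erase hv]
    · rwa [Finset.cons_eq_insert, Finset.insert_erase hv]
  -- Both interpolations agree on the wall, so they differ by a multiple of `c`.
  have hdiff : h' - h = (h' v - h v) • c := by
    refine AffineMap.ext_on (affineSpan_eq_top_of_card (K.indep hs) hcard)
      fun w hw => ?_
    rcases eq_or_ne w v with rfl | hne
    · simp [hcv]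
    · have : h' w = F w := hh' w (Finset.mem_insert_of_mem (Finset.mem_erase.2 ⟨hne, hw⟩))
      simp [hc0 w hw hne, this, hh w hw]
  have hev : ∀ x, h' x - h x = (h' v - h v) * c x := fun x => by
    simpa using congrArg (fun g : V →ᵃ[ℝ] ℝ => g x) hdiff
  have h1 : 0 < (h' v - h v) * c v' := by
    rw [← hev, hh' v' (Finset.mem_insert_self _ _)]
    linarith
  have h2 : h' v - h v < 0 := by
    by_contra! hk
    nlinarith
  have h3 := mul_pos_of_neg_of_neg h2 hcp
  rw [← hev] at h3
  linarith

/-- Local convexity is global: the affine interpolation on a cell is strictly below `F` at every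
other vertex. -/
theorem apply_lt_of_strictlyLocallyConvex (hK : K.faces.Finite) (hconv : Convex ℝ K.space)
    {F : V → ℝ} (hF : StrictlyLocallyConvex K F) {s : Finset V} (hs : s ∈ K.faces)
    (hcard : s.card = finrank ℝ V + 1) {h : V →ᵃ[ℝ] ℝ} (hh : ∀ q ∈ s, h q = F q)
    {p : V} (hp : p ∈ K.vertices) (hps : p ∉ s) : h p < F p := by
  have hex : ∀ s : K.faces, ∃ h : V →ᵃ[ℝ] ℝ, ∀ q ∈ s.1, h q = F q :=
    fun s => exists_affineMap_eqOn (K.indep s.2) F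
  choose H hH using hex
  have := hK.to_subtype
  -- Choose a cell maximizing the value at `p` of its interpolation; it has to contain `p`.
  obtain ⟨m, hmc, hmax⟩ := Set.exists_max_image {t : K.faces | t.1.card = finrank ℝ V + 1}
    (fun t => H t p) (Set.toFinite _) ⟨⟨s, hs⟩, hcard⟩
  have hpm : p ∈ m.1 := by
    by_contra hpm
    obtain ⟨s', hs', hc', hlt⟩ := exists_cell_lt_apply hK hconv hF m.2 hmc (hH m) hp hpm
    exact (hlt _ (hH ⟨s', hs'⟩)).not_ge (hmax ⟨s', hs'⟩ hc')
  obtain ⟨s', hs', hc', hlt⟩ := exists_cell_lt_apply hK hconv hF hs hcard hh hp hps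
  calc h p < H ⟨s', hs'⟩ p := hlt _ (hH ⟨s', hs'⟩)
    _ ≤ H m p := hmax ⟨s', hs'⟩ hc'
    _ = F p := hH m p hpm

end Complex

/-! ### Exposed faces of a polytope -/

theorem maximizers_convexHull {W : Type*} [NormedAddCommGroup W] [NormedSpace ℝ W] {P : Set W}
    (l : StrongDual ℝ W) {m : ℝ} (hm : ∀ p ∈ P, l p ≤ m) {p₀ : W} (hp₀ : p₀ ∈ P)
    (hlp₀ : l p₀ = m) :
    {x ∈ convexHull ℝ P | ∀ y ∈ convexHull ℝ P, l y ≤ l x} =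
      convexHull ℝ {p ∈ P | l p = m} := by
  let g : W →ᵃ[ℝ] ℝ := (l : W →ₗ[ℝ] ℝ).toAffineMap
  refine Eq.trans ?_ (convexHull_inter_level (h := g) (m := m) hm)
  have hle : ∀ y ∈ convexHull ℝ P, l y ≤ m := fun y hy =>
    affineMap_le_of_mem_convexHull (h := g) hm hy
  ext x
  constructor
  · rintro ⟨hx, hmax⟩
    exact ⟨hx, le_antisymm (hle x hx) (hlp₀ ▸ hmax p₀ (subset_convexHull ℝ P hp₀))⟩
  · rintro ⟨hx, hxm : l x = m⟩
    exact ⟨hx, fun y hy => hxm ▸ hle y hy⟩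

/-! ### The lower convex hull -/

section Lift

variable {d : ℕ} {F : EuclideanSpace ℝ (Fin d) → ℝ} {S : Finset (EuclideanSpace ℝ (Fin d))}

theorem exists_affineMap_eq_inner_add (a : EuclideanSpace ℝ (Fin d)) (b : ℝ) :
    ∃ h : EuclideanSpace ℝ (Fin d) →ᵃ[ℝ] ℝ, ∀ x, h x = inner ℝ a x + b :=
  ⟨(innerSL ℝ a : EuclideanSpace ℝ (Fin d) →ₗ[ℝ] ℝ).toAffineMap +
    AffineMap.const ℝ (EuclideanSpace ℝ (Fin d)) b, fun x => by simp⟩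

theorem exists_inner_add_eq_affineMap (h : EuclideanSpace ℝ (Fin d) →ᵃ[ℝ] ℝ) :
    ∃ (a : EuclideanSpace ℝ (Fin d)) (b : ℝ), ∀ x, h x = inner ℝ a x + b := by
  refine ⟨(InnerProductSpace.toDual ℝ _).symm h.linear.toContinuousLinearMap, h 0, fun x => ?_⟩
  rw [InnerProductSpace.toDual_symm_apply]
  simpa using congrFun h.decomp x

theorem fst_image_lift : Prod.fst '' lift F S = (S : Set (EuclideanSpace ℝ (Fin d))) := by
  simp [lift, Set.image_image]

theorem fst_image_convexHull_lift :
    Prod.fst '' convexHull ℝ (lift F S) = convexHull ℝ (S : Set (EuclideanSpace ℝ (Fin d))) := by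
  rw [← fst_image_lift (F := F)]
  exact (LinearMap.fst ℝ (EuclideanSpace ℝ (Fin d)) ℝ).image_convexHull _

/-- A supporting non-vertical hyperplane cuts the convex hull of the lifted points in the convex
hull of the lifted points that it contains. -/
theorem convexHull_lift_inter_hyperplane {a : EuclideanSpace ℝ (Fin d)} {b : ℝ}
    (hle : ∀ p ∈ S, inner ℝ a p + b ≤ F p) {t : Finset (EuclideanSpace ℝ (Fin d))}
    (ht : ∀ p, p ∈ t ↔ p ∈ S ∧ F p = inner ℝ a p + b) :
    convexHull ℝ (lift F S) ∩ hyperplane a b = convexHull ℝ (lift F t) := by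
  obtain ⟨h, hh⟩ := exists_affineMap_eq_inner_add a b
  let g : EuclideanSpace ℝ (Fin d) × ℝ →ᵃ[ℝ] ℝ :=
    h.comp (LinearMap.fst ℝ _ ℝ).toAffineMap - (LinearMap.snd ℝ _ ℝ).toAffineMap
  have hg : ∀ z, g z = inner ℝ a z.1 + b - z.2 := fun z => by simp [g, hh]
  have key := convexHull_inter_level (P := lift F S) (h := g) (m := 0) (by
    rintro _ ⟨p, hp, rfl⟩
    rw [hg]
    exact sub_nonpos.2 (hle p hp))
  have hhyp : {z | g z = 0} = hyperplane a b := by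
    ext z
    rw [Set.mem_ofPred_eq, hg, sub_eq_zero, eq_comm]
    rfl
  rw [← hhyp, key]
  congr 1
  ext z
  constructor
  · rintro ⟨⟨p, hp, rfl⟩, hz⟩
    rw [hg, sub_eq_zero] at hz
    exact ⟨p, (ht p).2 ⟨hp, hz.symm⟩, rfl⟩
  · rintro ⟨p, hp, rfl⟩
    have := (ht p).1 hp
    refine ⟨⟨p, this.1, rfl⟩, ?_⟩
    rw [hg, sub_eq_zero]
    exact this.2.symm

theorem affineSpan_lift_eq_hyperplane {t : Finset (EuclideanSpace ℝ (Fin d))}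
    (hspan : affineSpan ℝ (t : Set (EuclideanSpace ℝ (Fin d))) = ⊤)
    {a : EuclideanSpace ℝ (Fin d)} {b : ℝ} (hF : ∀ p ∈ t, F p = inner ℝ a p + b) :
    (affineSpan ℝ (lift F t) : Set (EuclideanSpace ℝ (Fin d) × ℝ)) = hyperplane a b := by
  obtain ⟨h, hh⟩ := exists_affineMap_eq_inner_add a b
  let L := (AffineMap.id ℝ (EuclideanSpace ℝ (Fin d))).prod h
  have hL : lift F t = L '' t := Set.image_congr fun p hp => by simp [L, hh, hF p hp]
  rw [hL, ← AffineSubspace.map_span, hspan, AffineSubspace.coe_map, AffineSubspace.top_coe,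
    Set.image_univ]
  ext z
  constructor
  · rintro ⟨x, rfl⟩
    exact hh x
  · intro hz
    exact ⟨z.1, Prod.ext rfl ((hh z.1).trans (Eq.symm hz))⟩

theorem affineSpan_eq_top_of_lift {t : Finset (EuclideanSpace ℝ (Fin d))}
    {a : EuclideanSpace ℝ (Fin d)} {b : ℝ}
    (hspan : (affineSpan ℝ (lift F t) : Set (EuclideanSpace ℝ (Fin d) × ℝ)) = hyperplane a b) :
    affineSpan ℝ (t : Set (EuclideanSpace ℝ (Fin d))) = ⊤ := by
  let π := (LinearMap.fst ℝ (EuclideanSpace ℝ (Fin d)) ℝ).toAffineMap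
  have h : affineSpan ℝ (t : Set (EuclideanSpace ℝ (Fin d))) =
      (affineSpan ℝ (lift F t)).map π := by
    rw [AffineSubspace.map_span, ← fst_image_lift (F := F)]
    rfl
  rw [h, ← AffineSubspace.coe_eq_univ_iff, AffineSubspace.coe_map, hspan]
  exact Set.eq_univ_of_forall fun x => ⟨(x, inner ℝ a x + b), rfl, rfl⟩

theorem exists_subset_of_isExposed_convexHull_lift {t : Finset (EuclideanSpace ℝ (Fin d))}
    {ψ : Set (EuclideanSpace ℝ (Fin d) × ℝ)} (hψ : ψ.Nonempty)
    (hexp : IsExposed ℝ (convexHull ℝ (lift F t)) ψ) :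
    ∃ s ⊆ t, s.Nonempty ∧ ψ = convexHull ℝ (lift F s) := by
  classical
  obtain ⟨l, hl⟩ := hexp hψ
  have hne : (t : Set (EuclideanSpace ℝ (Fin d))).Nonempty := by
    obtain ⟨z, hz⟩ := hψ
    have := convexHull_nonempty_iff.1 ⟨z, hexp.subset hz⟩
    rwa [← fst_image_lift (F := F), Set.image_nonempty]
  obtain ⟨p₀, hp₀, hmax⟩ := t.exists_max_image (fun p => l (p, F p)) hne
  refine ⟨{p ∈ t | l (p, F p) = l (p₀, F p₀)}, t.filter_subset _,
    ⟨p₀, Finset.mem_filter.2 ⟨hp₀, rfl⟩⟩, ?_⟩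
  rw [hl, maximizers_convexHull (P := lift F t) l (m := l (p₀, F p₀))
    (p₀ := (p₀, F p₀)) ?_ ⟨p₀, hp₀, rfl⟩ rfl]
  · congr 1
    ext z
    constructor
    · rintro ⟨⟨p, hp, rfl⟩, hz⟩
      exact ⟨p, Finset.mem_coe.2 (Finset.mem_filter.2 ⟨hp, hz⟩), rfl⟩
    · rintro ⟨p, hp, rfl⟩
      have := Finset.mem_filter.1 (Finset.mem_coe.1 hp)
      exact ⟨⟨p, this.1, rfl⟩, this.2⟩
  · rintro _ ⟨p, hp, rfl⟩
    exact hmax p hp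

theorem isExposed_convexHull_lift {s t : Finset (EuclideanSpace ℝ (Fin d))}
    (ht : AffineIndependent ℝ ((↑) : t → EuclideanSpace ℝ (Fin d))) (hst : s ⊆ t)
    (hs : s.Nonempty) : IsExposed ℝ (convexHull ℝ (lift F t)) (convexHull ℝ (lift F s)) := by
  classical
  -- The sum of the barycentric coordinates belonging to `s`, up to a constant.
  obtain ⟨c, hc⟩ := exists_affineMap_eqOn ht (fun v => if v ∈ s then 1 else 0)
  let l : StrongDual ℝ (EuclideanSpace ℝ (Fin d) × ℝ) :=
    c.linear.toContinuousLinearMap.comp (ContinuousLinearMap.fst ℝ _ ℝ)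
  have hl : ∀ p : EuclideanSpace ℝ (Fin d), l (p, F p) = c p - c 0 := fun p => by
    have := congrFun c.decomp p
    simp only [Pi.add_apply] at this
    simp [l, this]
  obtain ⟨p₀, hp₀⟩ := hs
  have hval : ∀ p ∈ t, (p ∈ s → l (p, F p) = 1 - c 0) ∧ (p ∉ s → l (p, F p) < 1 - c 0) :=
    fun p hp => ⟨fun h => by rw [hl, hc p hp, if_pos h], fun h => by
      rw [hl, hc p hp, if_neg h]
      linarith⟩
  refine fun _ => ⟨l, ?_⟩
  rw [maximizers_convexHull (P := lift F t) l (m := 1 - c 0) (p₀ := (p₀, F p₀)) ?_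
    ⟨p₀, hst hp₀, rfl⟩ ((hval p₀ (hst hp₀)).1 hp₀)]
  · congr 1
    ext z
    constructor
    · rintro ⟨p, hp, rfl⟩
      exact ⟨⟨p, hst hp, rfl⟩, (hval p (hst hp)).1 hp⟩
    · rintro ⟨⟨p, hp, rfl⟩, hz⟩
      exact ⟨p, by_contra fun h => ((hval p hp).2 h).ne hz, rfl⟩
  · rintro _ ⟨p, hp, rfl⟩
    by_cases h : p ∈ s
    · exact ((hval p hp).1 h).le
    · exact ((hval p hp).2 h).le

end Lift

/-! ### Triangulations and the Delaunay complex -/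

section Delaunay

variable {d : ℕ} {X : Set (EuclideanSpace ℝ (Fin d))} {F : EuclideanSpace ℝ (Fin d) → ℝ}
  {S : Finset (EuclideanSpace ℝ (Fin d))}
  {T : Geometry.SimplicialComplex ℝ (EuclideanSpace ℝ (Fin d))}

theorem IsTriangulation.subset (hT : IsTriangulation T S) {s : Finset (EuclideanSpace ℝ (Fin d))}
    (hs : s ∈ T.faces) : s ⊆ S := by
  intro p hp
  have : p ∈ T.vertices :=
    T.down_closed hs (Finset.singleton_subset_iff.2 hp) (Finset.singleton_nonempty p)
  rw [hT.vertices_eq] at this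
  exact this

theorem IsTriangulation.finite_faces (hT : IsTriangulation T S) : T.faces.Finite :=
  S.powerset.finite_toSet.subset fun _ hs =>
    Finset.mem_coe.2 (Finset.mem_powerset.2 (hT.subset hs))

theorem IsTriangulation.convex_space (hT : IsTriangulation T S) : Convex ℝ T.space :=
  hT.space_eq ▸ convex_convexHull ℝ _

/-- A full-dimensional cell of a strictly locally convex triangulation is exactly the set of points
of `S` at which its affine interpolation meets `F`; elsewhere the interpolation is below `F`. -/
theorem mem_cell_iff (hT : IsTriangulation T S) (hF : StrictlyLocallyConvex T F)
    {t : Finset (EuclideanSpace ℝ (Fin d))} (ht : t ∈ T.faces)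
    (hcard : t.card = finrank ℝ (EuclideanSpace ℝ (Fin d)) + 1)
    {h : EuclideanSpace ℝ (Fin d) →ᵃ[ℝ] ℝ} (hh : ∀ q ∈ t, h q = F q) :
    (∀ p ∈ S, h p ≤ F p) ∧ ∀ p, p ∈ t ↔ p ∈ S ∧ F p = h p := by
  have hlt : ∀ p ∈ S, p ∉ t → h p < F p := fun p hp hpt =>
    apply_lt_of_strictlyLocallyConvex hT.finite_faces hT.convex_space hF ht hcard hh
      (by rw [hT.vertices_eq]; exact hp) hpt
  refine ⟨fun p hp => ?_, fun p => ⟨fun hp => ⟨hT.subset ht hp, (hh p hp).symm⟩, fun hp => ?_⟩⟩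
  · by_cases hpt : p ∈ t
    · exact (hh p hpt).le
    · exact (hlt p hp hpt).le
  · by_contra hpt
    exact (hlt p hp.1 hpt).ne hp.2.symm

theorem IsTriangulation.exists_cell_superset
    (hspan : affineSpan ℝ (S : Set (EuclideanSpace ℝ (Fin d))) = ⊤) (hT : IsTriangulation T S)
    {f : Finset (EuclideanSpace ℝ (Fin d))} (hf : f ∈ T.faces) :
    ∃ t ∈ T.faces, f ⊆ t ∧ t.card = finrank ℝ (EuclideanSpace ℝ (Fin d)) + 1 := by
  refine BregmanGeometry.exists_cell_superset hT.finite_faces hT.convex_space ?_ hf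
  rw [hT.space_eq]
  exact interior_convexHull_nonempty_iff_affineSpan_eq_top.2 hspan

theorem simplices_subset_delaunay
    (hspan : affineSpan ℝ (S : Set (EuclideanSpace ℝ (Fin d))) = ⊤) (hT : IsTriangulation T S)
    (hF : StrictlyLocallyConvex T F) : simplices T ⊆ delaunay F S := by
  rintro _ ⟨s, hs, rfl⟩
  obtain ⟨t, ht, hst, hcard⟩ := hT.exists_cell_superset hspan hs
  obtain ⟨h, hh⟩ := exists_affineMap_eqOn (T.indep ht) F
  obtain ⟨hle, hmem⟩ := mem_cell_iff hT hF ht hcard hh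
  obtain ⟨a, b, hab⟩ := exists_inner_add_eq_affineMap h
  simp only [hab] at hle hmem
  refine ⟨convexHull ℝ (lift F t), ⟨a, b, ?_, ?_, ?_⟩, convexHull ℝ (lift F s), ?_, ?_, ?_⟩
  · rintro _ ⟨p, hp, rfl⟩
    exact hle p hp
  · exact (convexHull_lift_inter_hyperplane hle hmem).symm
  · rw [affineSpan_convexHull]
    exact affineSpan_lift_eq_hyperplane (affineSpan_eq_top_of_card (T.indep ht) hcard)
      fun p hp => ((hmem p).1 hp).2
  · exact ((Finset.coe_nonempty.2 (T.nonempty_of_mem_faces hs)).image _).convexHull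
  · exact isExposed_convexHull_lift (T.indep ht) hst (T.nonempty_of_mem_faces hs)
  · exact fst_image_convexHull_lift.symm

/-- The points of `S` on a hyperplane spanning a lower facet form a cell: at their barycentre this
hyperplane lies both above and below the hyperplane of the cell containing the barycentre. -/
theorem contact_set_mem_faces
    (hspan : affineSpan ℝ (S : Set (EuclideanSpace ℝ (Fin d))) = ⊤) (hT : IsTriangulation T S)
    (hF : StrictlyLocallyConvex T F) {g : EuclideanSpace ℝ (Fin d) →ᵃ[ℝ] ℝ}
    (hg : ∀ p ∈ S, g p ≤ F p) {u : Finset (EuclideanSpace ℝ (Fin d))}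
    (hu : ∀ p, p ∈ u ↔ p ∈ S ∧ F p = g p)
    (huspan : affineSpan ℝ (u : Set (EuclideanSpace ℝ (Fin d))) = ⊤) : u ∈ T.faces := by
  have hune : u.Nonempty := by
    rw [← Finset.coe_nonempty, ← affineSpan_nonempty ℝ, huspan]
    exact Set.univ_nonempty
  obtain ⟨x, hxu, hx⟩ := exists_mem_convexHull_card_mul_eq_sum hune
  have hxS : x ∈ T.space := by
    rw [hT.space_eq]
    exact convexHull_mono (fun p hp => ((hu p).1 hp).1) hxu
  obtain ⟨f, hf, hxf⟩ := Geometry.SimplicialComplex.mem_space_iff.1 hxS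
  obtain ⟨t, ht, hft, hcard⟩ := hT.exists_cell_superset hspan hf
  have hxt : x ∈ convexHull ℝ (t : Set (EuclideanSpace ℝ (Fin d))) := convexHull_mono hft hxf
  obtain ⟨h, hh⟩ := exists_affineMap_eqOn (T.indep ht) F
  obtain ⟨hle, hmem⟩ := mem_cell_iff hT hF ht hcard hh
  have hdiff : 0 ≤ (h - g) x := by
    have := affineMap_le_of_mem_convexHull (h := g - h) (m := 0) (fun p hp => by
      simpa [hh p hp] using hg p (hT.subset ht hp)) hxt
    simp only [AffineMap.coe_sub, Pi.sub_apply] at this ⊢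
    linarith
  have hnonpos : ∀ p ∈ u, (h - g) p ≤ 0 := fun p hp => by
    have := (hu p).1 hp
    simpa [← this.2] using hle p this.1
  -- A nonnegative sum of nonpositive terms has vanishing terms.
  have hsum : ∑ p ∈ u, (h - g) p = 0 :=
    le_antisymm (Finset.sum_nonpos hnonpos) (hx (h - g) ▸ by positivity)
  have hzero := (Finset.sum_eq_zero_iff_of_nonpos hnonpos).1 hsum
  have hhg : h = g := AffineMap.ext_on huspan fun p hp => sub_eq_zero.1 (by simpa using hzero p hp)
  have hut : u = t := Finset.ext fun p => by rw [hu, hmem, hhg]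
  exact hut ▸ ht

theorem delaunay_subset_simplices
    (hspan : affineSpan ℝ (S : Set (EuclideanSpace ℝ (Fin d))) = ⊤) (hT : IsTriangulation T S)
    (hF : StrictlyLocallyConvex T F) : delaunay F S ⊆ simplices T := by
  classical
  rintro _ ⟨_, ⟨a, b, hle, rfl, hφ⟩, ψ, hψ, hexp, rfl⟩
  have hle' : ∀ p ∈ S, inner ℝ a p + b ≤ F p := fun p hp => hle _ ⟨p, hp, rfl⟩
  have hu : ∀ p, p ∈ {p ∈ S | F p = inner ℝ a p + b} ↔ p ∈ S ∧ F p = inner ℝ a p + b :=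
    fun p => Finset.mem_filter
  rw [convexHull_lift_inter_hyperplane hle' hu] at hexp hφ
  rw [affineSpan_convexHull] at hφ
  obtain ⟨g, hg⟩ := exists_affineMap_eq_inner_add a b
  have hface : {p ∈ S | F p = inner ℝ a p + b} ∈ T.faces :=
    contact_set_mem_faces (g := g) hspan hT hF (by simpa only [hg] using hle')
      (by simpa only [hg] using hu) (affineSpan_eq_top_of_lift hφ)
  obtain ⟨s, hs, hsne, rfl⟩ := exists_subset_of_isExposed_convexHull_lift hψ hexp
  exact ⟨s, T.down_closed hface hs hsne, fst_image_convexHull_lift⟩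

/-- Regular pairs whose `d + 2` vertices do not lie on one section are strictly convex: the
hyperplane through a cell passes strictly below the lifted opposite vertex. -/
theorem strictlyLocallyConvex_of_sections (hT : IsTriangulation T S)
    (hSX : (S : Set (EuclideanSpace ℝ (Fin d))) ⊆ X)
    (hreg : ∀ (f : Finset (EuclideanSpace ℝ (Fin d))) (p₁ p₂ : EuclideanSpace ℝ (Fin d))
      (h₁ : p₁ ∉ f) (h₂ : p₂ ∉ f), p₁ ≠ p₂ →
      Finset.cons p₁ f h₁ ∈ T.facets → Finset.cons p₂ f h₂ ∈ T.facets →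
      ∃ (a : EuclideanSpace ℝ (Fin d)) (b : ℝ),
        (Finset.cons p₂ f h₂ : Set (EuclideanSpace ℝ (Fin d))) ⊆ section_ X F a b ∧
        p₁ ∉ openCap X F a b ∧
        ∀ U : Finset (EuclideanSpace ℝ (Fin d)), U ⊆ S → U.card = d + 2 →
          ¬ (U : Set (EuclideanSpace ℝ (Fin d))) ⊆ section_ X F a b) :
    StrictlyLocallyConvex T F := by
  classical
  intro f p₁ p₂ h₁ h₂ hne hfcard hc₁ hc₂ h hh
  have hfacet : ∀ t ∈ T.faces, t.card = finrank ℝ (EuclideanSpace ℝ (Fin d)) + 1 →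
      t ∈ T.facets := fun t ht hcard =>
    ⟨ht, fun u hu htu => Finset.eq_of_subset_of_card_le htu
      (hcard ▸ card_le_of_affineIndependent (T.indep hu))⟩
  have hcard₂ : (Finset.cons p₂ f h₂).card = finrank ℝ (EuclideanSpace ℝ (Fin d)) + 1 := by
    rw [Finset.card_cons, hfcard]
  obtain ⟨a, b, hsec, hcap, hgp⟩ := hreg f p₁ p₂ h₁ h₂ hne
    (hfacet _ hc₁ (by rw [Finset.card_cons, hfcard])) (hfacet _ hc₂ hcard₂)
  obtain ⟨g, hg⟩ := exists_affineMap_eq_inner_add a b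
  have hhg : h = g := AffineMap.ext_on (affineSpan_eq_top_of_card (T.indep hc₂) hcard₂)
    fun q hq => by rw [hh q hq, hg, (hsec hq).2]
  have hp₁S : p₁ ∈ S := hT.subset hc₁ (Finset.mem_cons_self _ _)
  rw [hhg, hg]
  have hle : inner ℝ a p₁ + b ≤ F p₁ := not_lt.1 fun hlt => hcap ⟨hSX hp₁S, hlt⟩
  refine lt_of_le_of_ne hle fun heq => ?_
  have hp₁ : p₁ ∉ Finset.cons p₂ f h₂ := by
    simp [hne, h₁]
  refine hgp (insert p₁ (Finset.cons p₂ f h₂)) (Finset.insert_subset hp₁S (hT.subset hc₂)) ?_ ?_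
  · rw [Finset.card_insert_of_notMem hp₁, hcard₂, finrank_euclideanSpace_fin]
  · rw [Finset.coe_insert]
    exact Set.insert_subset ⟨hSX hp₁S, heq.symm⟩ hsec

end Delaunay

end BregmanGeometry

theorem mainTheorem10 (d : ℕ) (X : Set (EuclideanSpace ℝ (Fin d)))
    (hXo : IsOpen X) (hXc : Convex ℝ X)
    (F : EuclideanSpace ℝ (Fin d) → ℝ)
    (hFc : StrictConvexOn ℝ X F) (hFd : DifferentiableOn ℝ F X)
    (S : Finset (EuclideanSpace ℝ (Fin d)))
    (hSX : (S : Set (EuclideanSpace ℝ (Fin d))) ⊆ X)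
    (hSspan : affineSpan ℝ (S : Set (EuclideanSpace ℝ (Fin d))) = ⊤)
    (T : Geometry.SimplicialComplex ℝ (EuclideanSpace ℝ (Fin d)))
    (hT : BregmanGeometry.IsTriangulation T S) :
    (BregmanGeometry.GeneralPosition X F S → BregmanGeometry.AllPairsRegular X F T →
      BregmanGeometry.simplices T = BregmanGeometry.delaunay F S) ∧
    (BregmanGeometry.LiftedGeneralPosition X F S →
      BregmanGeometry.AllPairsLiftedRegular X F T →
      BregmanGeometry.simplices T = BregmanGeometry.delaunay F S) := by
  have key : BregmanGeometry.StrictlyLocallyConvex T F →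
      BregmanGeometry.simplices T = BregmanGeometry.delaunay F S := fun hF =>
    (BregmanGeometry.simplices_subset_delaunay hSspan hT hF).antisymm
      (BregmanGeometry.delaunay_subset_simplices hSspan hT hF)
  refine ⟨fun hgp hreg => key ?_, fun hgp hreg => key ?_⟩
  · refine BregmanGeometry.strictlyLocallyConvex_of_sections hT hSX
      fun f p₁ p₂ h₁ h₂ hne hf₁ hf₂ => ?_
    obtain ⟨c, hc, r, hsub, hout⟩ := (hreg f p₁ p₂ h₁ h₂ hne hf₁ hf₂).1
    rw [BregmanGeometry.sphere_eq_section] at hsub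
    rw [BregmanGeometry.openBall_eq_openCap] at hout
    refine ⟨_, _, hsub, hout, fun U hU hcard => ?_⟩
    rw [← BregmanGeometry.sphere_eq_section]
    exact hgp U hU hcard c hc r
  · refine BregmanGeometry.strictlyLocallyConvex_of_sections hT hSX
      fun f p₁ p₂ h₁ h₂ hne hf₁ hf₂ => ?_
    obtain ⟨a, b, hsub, hout⟩ := (hreg f p₁ p₂ h₁ h₂ hne hf₁ hf₂).1
    exact ⟨a, b, hsub, hout, fun U hU hcard => hgp U hU hcard a b⟩
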